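/- Let $a<b$ be real numbers and let $$A=\{(x,y)\in\mathbb R/\mathbb Z\times\mathbb R \mid a\le y\le b\}$$ be the annulus, with universal covering $\mathbb R\times[a,b]\subset\mathbb R^2$. Let $$B_n=\langle \sigma_1,\dots,\sigma_{n-1}\mid \sigma_i\sigma_j=\sigma_j\sigma_i\ (|i-j|>1),\ \sigma_i\sigma_j\sigma_i=\sigma_j\sigma_i\sigma_j\ (|i-j|=1)\rangle$$ be the braid group on $n$ strands. For points $a_1,\dots,a_n$ on a horizontal line in $\mathbb R^2$, numbered from left to right, a geometric braid with end points $a_1,\dots,a_n$ is a family of $n$ continuous paths $\gamma_i:[0,1]\to\mathbb R^2$ with $\gamma_i(0)=a_i$ and $\gamma_i(1)=a_{\pi(i)}$ for some permutation $\pi$, such that $\gamma_1(t),\dots,\gamma_n(t)$ are pairwise distinct for every $t\in[0,1]$. It represents $\beta\in B_n$ if it can be joined, by a continuous one-parameter family of geometric braids with the same end points, to the concatenation (first letter performed first) of the elementary braids of a word in the letters $\sigma_i^{\pm1}$ whose value in $B_n$ is $\beta$. Here the elementary braid of $\sigma_i$ (resp. $\sigma_i^{-1}$) rotates $a_i$ and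 $a_{i+1}$ clockwise (resp. counterclockwise) by the angle $\pi$ about their midpoint and leaves the other points at rest. **Theorem.** For every $n$ and every braid $\beta\in B_n$ there is a Hamiltonian function $H=H(t,x,y)\in C^\infty(\mathbb R/\mathbb Z\times A)$ such that the Hamiltonian system $$\dot x=H_y(t,x,y),\qquad \dot y=-H_x(t,x,y)$$ has a flow $\varphi_t$, with $\varphi_0=\mathrm{id}$, defined on all of $\mathbb R\times[a,b]$ for all times $t\in\mathbb R$, and there are $n$ points $a_1=(x_1,c),\dots,a_n=(x_n,c)$ in $\mathbb R\times[a,b]$ with $x_1<\dots<x_n$ and $x_i<x_j+1$ for all $i,j$ (so that they are also distinct as points of $A$), for which the trajectories $t\mapsto\varphi_t(a_i)$, $t\in[0,1]$, form a geometric braid with end points $a_1,\dots,a_n$ that represents $\beta$. -/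

import Mathlib

open scoped ContDiff unitInterval

/-! ### The braid group -/

/-- The relators of Artin's presentation on the generators `σ_0, …, σ_{n-2}`. -/
def braidRelators (n : ℕ) : Set (FreeGroup (Fin (n - 1))) :=
  {r | (∃ i j : Fin (n - 1), ((i : ℕ) + 1 < j ∨ (j : ℕ) + 1 < i) ∧
          r = FreeGroup.of i * FreeGroup.of j * (FreeGroup.of j * FreeGroup.of i)⁻¹) ∨
       (∃ i j : Fin (n - 1), ((i : ℕ) + 1 = j ∨ (j : ℕ) + 1 = i) ∧
          r = FreeGroup.of i * FreeGroup.of j * FreeGroup.of i *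
            (FreeGroup.of j * FreeGroup.of i * FreeGroup.of j)⁻¹)}

/-- The braid group `B_n` on `n` strands, given by Artin's presentation. -/
abbrev BraidGroup (n : ℕ) : Type := PresentedGroup (braidRelators n)

/-! ### Geometric braids in the plane -/

/-- A geometric braid in `ℝ² × [0,1]` with end points `p_0, …, p_{n-1}`: `n` paths in the plane,
parametrised by the height `t ∈ [0,1]`, the `i`-th one running from `p_i` to `p_{perm i}`, which
are at pairwise distinct points at each height. -/
structure GeometricBraid {n : ℕ} (p : Fin n → ℝ × ℝ) where
  perm : Equiv.Perm (Fin n)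
  strand : ∀ i, Path (p i) (p (perm i))
  disjoint : ∀ t : I, Function.Injective fun i => strand i t

namespace GeometricBraid

variable {n : ℕ} {p : Fin n → ℝ × ℝ}

/-- Two geometric braids with the same end points are isotopic if they are joined by a continuous
one-parameter family of geometric braids with these end points. -/
def Isotopic (β γ : GeometricBraid p) : Prop :=
  ∃ F : I → GeometricBraid p,
    (∀ i, Continuous fun q : I × I => (F q.1).strand i q.2) ∧
    (∀ i t, (F 0).strand i t = β.strand i t) ∧
    (∀ i t, (F 1).strand i t = γ.strand i t)

/-- The braid with constant strands. -/
def trivial (hp : Function.Injective p) : GeometricBraid p where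
  perm := 1
  strand i := Path.refl (p i)
  disjoint _ := hp

/-- The product of geometric braids: first `β` on `[0,1/2]`, then `γ` on `[1/2,1]`. -/
noncomputable def comp (β γ : GeometricBraid p) : GeometricBraid p where
  perm := β.perm.trans γ.perm
  strand i := (β.strand i).trans (γ.strand (β.perm i))
  disjoint t i j h := by
    have h := (Path.trans_apply (β.strand i) (γ.strand (β.perm i)) t).symm.trans
      (h.trans (Path.trans_apply (β.strand j) (γ.strand (β.perm j)) t))
    split_ifs at h with ht
    · exact β.disjoint _ h
    · exact β.perm.injective (γ.disjoint _ h)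

end GeometricBraid

/-- The points `(x_0, c), …, (x_{n-1}, c)` on the horizontal line `y = c`. -/
def linePoints {n : ℕ} (x : Fin n → ℝ) (c : ℝ) : Fin n → ℝ × ℝ := fun i => (x i, c)

theorem linePoints_injective {n : ℕ} {x : Fin n → ℝ} (hx : StrictMono x) (c : ℝ) :
    Function.Injective (linePoints x c) :=
  fun _ _ h => hx.injective (congrArg Prod.fst h)

/-- The position `i` in `Fin n` of the left one of the two strands exchanged by `σ_i`. -/
def leftStrand {n : ℕ} (i : Fin (n - 1)) : Fin n := ⟨i, by omega⟩

/-- The position `i + 1` in `Fin n` of the right one of the two strands exchanged by `σ_i`. -/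
def rightStrand {n : ℕ} (i : Fin (n - 1)) : Fin n := ⟨i + 1, by omega⟩

/-- The motion of the `j`-th point in the half twist of the points `i` and `i + 1`: these two
rotate by the angle `π` about their midpoint, clockwise if `s = 1` and counterclockwise if
`s = -1`, and all other points rest. -/
noncomputable def halfTwistFun {n : ℕ} (x : Fin n → ℝ) (c : ℝ) (i : Fin (n - 1)) (s : ℝ)
    (j : Fin n) (t : ℝ) : ℝ × ℝ :=
  let m := (x (leftStrand i) + x (rightStrand i)) / 2
  let d := (x (rightStrand i) - x (leftStrand i)) / 2
  if j = leftStrand i then (m - d * Real.cos (Real.pi * t), c + s * d * Real.sin (Real.pi * t))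
  else if j = rightStrand i then
    (m + d * Real.cos (Real.pi * t), c - s * d * Real.sin (Real.pi * t))
  else (x j, c)

theorem leftStrand_lt_rightStrand {n : ℕ} (i : Fin (n - 1)) :
    leftStrand i < rightStrand i := by
  simp [leftStrand, rightStrand, Fin.lt_def]

theorem halfTwistFun_continuous {n : ℕ} (x : Fin n → ℝ) (c : ℝ) (i : Fin (n - 1)) (s : ℝ)
    (j : Fin n) : Continuous (halfTwistFun x c i s j) := by
  unfold halfTwistFun
  split_ifs <;> fun_prop

theorem halfTwistFun_zero {n : ℕ} (x : Fin n → ℝ) (c : ℝ) (i : Fin (n - 1)) (s : ℝ)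
    (j : Fin n) : halfTwistFun x c i s j 0 = linePoints x c j := by
  unfold halfTwistFun linePoints
  split_ifs with h1 h2
  · subst h1; ext <;> simp; ring
  · subst h2; ext <;> simp; ring
  · rfl

theorem halfTwistFun_one {n : ℕ} (x : Fin n → ℝ) (c : ℝ) (i : Fin (n - 1)) (s : ℝ)
    (j : Fin n) : halfTwistFun x c i s j 1 =
      linePoints x c (Equiv.swap (leftStrand i) (rightStrand i) j) := by
  unfold halfTwistFun linePoints
  split_ifs with h1 h2
  · subst h1; ext <;> simp; ring
  · subst h2; ext <;> simp; ring
  · rw [Equiv.swap_apply_of_ne_of_ne h1 h2]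

theorem halfTwistFun_injective {n : ℕ} {x : Fin n → ℝ} (hx : StrictMono x) (c : ℝ)
    (i : Fin (n - 1)) {s : ℝ} (hs : s ≠ 0) (t : ℝ) :
    Function.Injective fun j => halfTwistFun x c i s j t := by
  have hlr := hx (leftStrand_lt_rightStrand i)
  have hsc := Real.sin_sq_add_cos_sq (Real.pi * t)
  have hd : 0 < (x (rightStrand i) - x (leftStrand i)) / 2 := by linarith
  -- no third point lies on the segment swept out by the two moving points
  have key : ∀ k, k ≠ leftStrand i → k ≠ rightStrand i → ∀ u : ℝ, -1 ≤ u → u ≤ 1 →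
      x k ≠ (x (leftStrand i) + x (rightStrand i)) / 2 +
        (x (rightStrand i) - x (leftStrand i)) / 2 * u := by
    intro k hl hr u hu1 hu2 hk
    have h1 : x (leftStrand i) ≤ x k := by nlinarith
    have h2 : x k ≤ x (rightStrand i) := by nlinarith
    rw [hx.le_iff_le] at h1 h2
    have h3 := lt_of_le_of_ne h1 hl.symm
    have h4 := lt_of_le_of_ne h2 hr
    simp only [leftStrand, rightStrand, Fin.lt_def] at h3 h4
    omega
  have hc1 := Real.neg_one_le_cos (Real.pi * t)
  have hc2 := Real.cos_le_one (Real.pi * t)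
  have meet : ∀ u v : ℝ, u ^ 2 + v ^ 2 = 1 →
      ¬ ((x (leftStrand i) + x (rightStrand i)) / 2 -
          (x (rightStrand i) - x (leftStrand i)) / 2 * v =
          (x (leftStrand i) + x (rightStrand i)) / 2 +
          (x (rightStrand i) - x (leftStrand i)) / 2 * v ∧
        c + s * ((x (rightStrand i) - x (leftStrand i)) / 2) * u =
          c - s * ((x (rightStrand i) - x (leftStrand i)) / 2) * u) := by
    rintro u v huv ⟨h1, h2⟩
    have hv : (x (rightStrand i) - x (leftStrand i)) / 2 * v = 0 := by linarith
    have hu : s * ((x (rightStrand i) - x (leftStrand i)) / 2) * u = 0 := by linarith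
    have hv0 : v = 0 := (mul_eq_zero.mp hv).resolve_left hd.ne'
    have hu0 : u = 0 := (mul_eq_zero.mp hu).resolve_left (mul_ne_zero hs hd.ne')
    simp [hv0, hu0] at huv
  intro j k h
  simp only [halfTwistFun] at h
  split_ifs at h with h1 h2 h3 h4 h5 h6 h7 h8
  · rw [h1, h2]
  · exact absurd (Prod.mk.inj h) (meet _ _ hsc)
  · exact absurd (by linarith [(Prod.mk.inj h).1])
      (key k h2 h3 (-Real.cos (Real.pi * t)) (by linarith) (by linarith))
  · exact absurd ⟨(Prod.mk.inj h).1.symm, (Prod.mk.inj h).2.symm⟩ (meet _ _ hsc)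
  · rw [h4, h6]
  · exact absurd (Prod.mk.inj h).1.symm (key k h5 h6 _ hc1 hc2)
  · exact absurd (by linarith [(Prod.mk.inj h).1])
      (key j h1 h4 (-Real.cos (Real.pi * t)) (by linarith) (by linarith))
  · exact absurd (Prod.mk.inj h).1 (key j h1 h4 _ hc1 hc2)
  · exact hx.injective (Prod.mk.inj h).1

/-- The elementary geometric braid `σ_i` (for `e = true`) or `σ_i⁻¹` (for `e = false`) with end
points `(x_0, c), …, (x_{n-1}, c)`, where `x_0 < … < x_{n-1}`. -/
noncomputable def halfTwist {n : ℕ} {x : Fin n → ℝ} (hx : StrictMono x) (c : ℝ)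
    (i : Fin (n - 1)) (e : Bool) : GeometricBraid (linePoints x c) where
  perm := Equiv.swap (leftStrand i) (rightStrand i)
  strand j :=
    { toFun := fun t => halfTwistFun x c i (if e then 1 else -1) j t
      continuous_toFun := (halfTwistFun_continuous x c i _ j).comp continuous_subtype_val
      source' := halfTwistFun_zero x c i _ j
      target' := halfTwistFun_one x c i _ j }
  disjoint t := halfTwistFun_injective hx c i (by split_ifs <;> norm_num) t

/-- The geometric braid of a word in the letters `σ_i` (written `(i, true)`) and `σ_i⁻¹`
(written `(i, false)`): the product of the elementary braids of its letters, the first letter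
being performed first. -/
noncomputable def wordBraid {n : ℕ} {x : Fin n → ℝ} (hx : StrictMono x) (c : ℝ) :
    List (Fin (n - 1) × Bool) → GeometricBraid (linePoints x c)
  | [] => GeometricBraid.trivial (linePoints_injective hx c)
  | l :: w => (halfTwist hx c l.1 l.2).comp (wordBraid hx c w)

/-- A geometric braid with end points `(x_0, c), …, (x_{n-1}, c)`, where `x_0 < … < x_{n-1}`,
represents `g ∈ B_n`: it is isotopic to the product of elementary braids along a word for `g`.
As the relations of `B_n` hold for geometric braids up to isotopy, it does not matter which word
for `g` is taken. -/
def GeometricBraid.Represents {n : ℕ} {x : Fin n → ℝ} {c : ℝ}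
    (β : GeometricBraid (linePoints x c)) (hx : StrictMono x) (g : BraidGroup n) : Prop :=
  ∃ w : List (Fin (n - 1) × Bool),
    PresentedGroup.mk (braidRelators n) (FreeGroup.mk w) = g ∧ β.Isotopic (wordBraid hx c w)

/-! ### Hamiltonian systems on the annulus -/

/-- `H = H(t,x,y)` is a function of class `C^∞` on `ℝ/ℤ × A`, where
`A = ℝ/ℤ × [a,b]`, written as a function on `ℝ × ℝ × [a,b]` that has period `1` in `t` and
in `x` (its values for `y ∉ [a,b]` play no role). -/
structure IsSmoothHamiltonian (a b : ℝ) (H : ℝ → ℝ → ℝ → ℝ) : Prop where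
  smooth : ContDiffOn ℝ ∞ (fun q : ℝ × ℝ × ℝ => H q.1 q.2.1 q.2.2) {q | q.2.2 ∈ Set.Icc a b}
  periodic_t : ∀ t x, ∀ y ∈ Set.Icc a b, H (t + 1) x y = H t x y
  periodic_x : ∀ t x, ∀ y ∈ Set.Icc a b, H t (x + 1) y = H t x y

/-- `φ` is the flow, starting at time `0`, of `x' = H_y(t,x,y)`, `y' = -H_x(t,x,y)` on the
universal covering `ℝ × [a,b]` of the annulus `A`; in particular all solutions exist for all times
and stay in `ℝ × [a,b]`. The derivative `H_y` is one-sided for `y = a, b`. -/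
structure IsHamiltonianFlow (a b : ℝ) (H : ℝ → ℝ → ℝ → ℝ) (φ : ℝ → ℝ × ℝ → ℝ × ℝ) : Prop where
  init : ∀ q : ℝ × ℝ, q.2 ∈ Set.Icc a b → φ 0 q = q
  mem : ∀ t, ∀ q : ℝ × ℝ, q.2 ∈ Set.Icc a b → (φ t q).2 ∈ Set.Icc a b
  deriv_x : ∀ t, ∀ q : ℝ × ℝ, q.2 ∈ Set.Icc a b →
    HasDerivAt (fun s => (φ s q).1)
      (derivWithin (fun y => H t (φ t q).1 y) (Set.Icc a b) (φ t q).2) t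
  deriv_y : ∀ t, ∀ q : ℝ × ℝ, q.2 ∈ Set.Icc a b →
    HasDerivAt (fun s => (φ s q).2) (-deriv (fun x => H t x (φ t q).2) (φ t q).1) t

/-!
The theorem holds because a half twist of two neighbouring points is a Hamiltonian motion supported
in a small disc. A Hamiltonian `ρ(t) h(r²)`, with `r` the distance to a centre, preserves `r` and
rotates the circle of radius `r` clockwise with angular speed `2 ρ(t) h'(r²)`. Take equally spaced
points at the middle height of the annulus, occupying less than one period, the midpoint of two
neighbours as centre, and `h` (`twistProfile`) with support in a disc that lies in the annulus and
contains no third point. If `∫ ρ = ± π / 2` and `h' = 1` on the circle through the two points, then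
the flow exchanges them by a half twist and leaves the other points at rest
(`isUnitTimeMotion_twist`, `twistMap_eq_halfTwistFun`). All flows are given by explicit formulas, so
no existence theorem for differential equations is needed.

With `ρ` a multiple of the derivative of `Real.smoothTransition`, the Hamiltonian is switched off
outside the time interval `[0, 1]`. Hence motions can be performed one after the other
(`IsUnitTimeMotion.trans`), which realises the letters of a word for the braid in turn
(`exists_motion_wordBraid`), and the result can be repeated with period `1` in time
(`IsUnitTimeMotion.isHamiltonianFlow`). The trajectories run through the elementary braids of the
word at a nonuniform speed; a straight-line homotopy of time parametrisations makes the speed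
uniform, and this is the required isotopy (`wordBraidReparam_isotopic`).
-/

/-! ### Functions supported in a period -/

/-- If `f` vanishes outside `(0, 1)`, its periodic extension `f ∘ Int.fract` is, near any point of
`(k - 1, k + 1)`, a sum of two translates of `f`. -/
theorem apply_fract_eq_add {M : Type*} [AddMonoid M] {f : ℝ → M} (h0 : ∀ t ≤ 0, f t = 0)
    (h1 : ∀ t, 1 ≤ t → f t = 0) {k : ℤ} {t : ℝ} (hl : k - 1 < t) (hr : t < k + 1) :
    f (Int.fract t) = f (t - k + 1) + f (t - k) := by
  rcases le_or_gt (k : ℝ) t with h | h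
  · have : Int.fract t = t - k := by
      rw [Int.fract_eq_iff]; exact ⟨by linarith, by linarith, k, by ring⟩
    rw [this, h1 (t - k + 1) (by linarith), zero_add]
  · have : Int.fract t = t - k + 1 := by
      rw [Int.fract_eq_iff]
      exact ⟨by linarith, by linarith, k - 1, by push_cast; ring⟩
    rw [this, h0 (t - k) (by linarith), add_zero]

theorem eventually_mem_floor_Ioo (t : ℝ) :
    ∀ᶠ s in nhds t, (⌊t⌋ : ℝ) - 1 < s ∧ s < ⌊t⌋ + 1 :=
  Ioo_mem_nhds (by linarith [Int.floor_le t]) (Int.lt_floor_add_one t)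

theorem ContDiff.comp_fract_fst {E : Type*} [NormedAddCommGroup E] [NormedSpace ℝ E]
    {f : ℝ × E → ℝ} (hf : ContDiff ℝ ∞ f) (h0 : ∀ t z, t ≤ 0 → f (t, z) = 0)
    (h1 : ∀ t z, 1 ≤ t → f (t, z) = 0) :
    ContDiff ℝ ∞ fun p : ℝ × E => f (Int.fract p.1, p.2) := by
  rw [contDiff_iff_contDiffAt]
  intro p
  have hloc : (fun p : ℝ × E => f (Int.fract p.1, p.2)) =ᶠ[nhds p] fun q =>
      f (q.1 - ⌊p.1⌋ + 1, q.2) + f (q.1 - ⌊p.1⌋, q.2) := by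
    filter_upwards [continuous_fst.continuousAt.eventually (eventually_mem_floor_Ioo p.1)]
      with q hq
    exact apply_fract_eq_add (f := fun t => f (t, q.2)) (fun t => h0 t q.2) (fun t => h1 t q.2)
      hq.1 hq.2
  refine ContDiffAt.congr_of_eventuallyEq (ContDiff.contDiffAt ?_) hloc
  exact (hf.comp (by fun_prop)).add (hf.comp (by fun_prop))

theorem HasDerivAt.eq_zero_of_eqOn_Iic {f : ℝ → ℝ} {f' c t : ℝ} (hf : HasDerivAt f f' t)
    (h : ∀ s ≤ t, f s = c) : f' = 0 := by
  refine (uniqueDiffWithinAt_Iic t).eq_deriv _ hf.hasDerivWithinAt ?_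
  exact (hasDerivWithinAt_const t _ c).congr h (h t le_rfl)

theorem HasDerivAt.eq_zero_of_eqOn_Ici {f : ℝ → ℝ} {f' c t : ℝ} (hf : HasDerivAt f f' t)
    (h : ∀ s, t ≤ s → f s = c) : f' = 0 := by
  refine (uniqueDiffWithinAt_Ici t).eq_deriv _ hf.hasDerivWithinAt ?_
  exact (hasDerivWithinAt_const t _ c).congr h (h t le_rfl)

theorem hasDerivAt_comp_fract {f f' : ℝ → ℝ} (hf : ∀ t, HasDerivAt f (f' t) t)
    (h0 : ∀ t ≤ 0, f t = 0) (h1 : ∀ t, 1 ≤ t → f t = 0) (t : ℝ) :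
    HasDerivAt (fun t => f (Int.fract t)) (f' (Int.fract t)) t := by
  have hloc : (fun t => f (Int.fract t)) =ᶠ[nhds t] fun s => f (s - ⌊t⌋ + 1) + f (s - ⌊t⌋) :=
    (eventually_mem_floor_Ioo t).mono fun s hs => apply_fract_eq_add h0 h1 hs.1 hs.2
  have h := (eventually_mem_floor_Ioo t).self_of_nhds
  have h0' : ∀ t ≤ 0, f' t = 0 := fun t ht =>
    (hf t).eq_zero_of_eqOn_Iic fun s hs => h0 s (hs.trans ht)
  have h1' : ∀ t, 1 ≤ t → f' t = 0 := fun t ht =>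
    (hf t).eq_zero_of_eqOn_Ici fun s hs => h1 s (ht.trans hs)
  rw [apply_fract_eq_add h0' h1' h.1 h.2]
  refine HasDerivAt.congr_of_eventuallyEq ?_ hloc
  have e1 := (hf (t - ⌊t⌋ + 1)).comp t (((hasDerivAt_id t).sub_const (⌊t⌋ : ℝ)).add_const 1)
  have e2 := (hf (t - ⌊t⌋)).comp t ((hasDerivAt_id t).sub_const (⌊t⌋ : ℝ))
  rw [mul_one] at e1 e2
  exact e1.add e2

/-! ### Trajectories of Hamiltonian systems -/

/-- The curve `γ` satisfies `x' = H_y(t,x,y)`, `y' = -H_x(t,x,y)` at time `t`. -/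
def SolvesAt (H : ℝ → ℝ → ℝ → ℝ) (γ : ℝ → ℝ × ℝ) (t : ℝ) : Prop :=
  HasDerivAt γ (deriv (fun y => H t (γ t).1 y) (γ t).2,
    -deriv (fun x => H t x (γ t).2) (γ t).1) t

namespace SolvesAt

variable {H H₁ H₂ : ℝ → ℝ → ℝ → ℝ} {γ γ₁ γ₂ : ℝ → ℝ × ℝ} {t τ : ℝ}

theorem congr (h : SolvesAt H₁ γ₁ t) (hγ : γ =ᶠ[nhds t] γ₁)
    (hH : ∀ x y, H t x y = H₁ t x y) : SolvesAt H γ t := by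
  unfold SolvesAt at *
  simp only [hγ.self_of_nhds, hH]
  exact h.congr_of_eventuallyEq hγ

theorem comp_affine {r s : ℝ} (h : SolvesAt H γ (r * t + s)) :
    SolvesAt (fun t x y => r * H (r * t + s) x y) (fun t => γ (r * t + s)) t := by
  unfold SolvesAt at *
  have e : HasDerivAt (fun t => r * t + s) r t := by
    simpa using ((hasDerivAt_id t).const_mul r).add_const s
  have := h.scomp t e
  simp only [deriv_const_mul_field]
  simpa [Function.comp_def] using this

theorem hasDerivAt_zero (h : SolvesAt H γ t) (hH : ∀ x y, H t x y = 0) :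
    HasDerivAt γ 0 t := by
  unfold SolvesAt at h
  simp only [hH, deriv_const, neg_zero] at h
  exact h

/-- If `H₁` is switched off at time `τ` and `H₂` is switched on at time `τ`, following a trajectory
of `H₁` up to `τ` and a trajectory of `H₂` from then on gives a trajectory of `H₁ + H₂`. -/
theorem glue (h₁ : SolvesAt H₁ γ₁ t) (h₂ : SolvesAt H₂ γ₂ t)
    (hH₁ : ∀ t x y, τ ≤ t → H₁ t x y = 0) (hH₂ : ∀ t x y, t ≤ τ → H₂ t x y = 0)
    (hγ₁ : ∀ t ≤ τ, γ t = γ₁ t) (hγ₂ : ∀ t, τ ≤ t → γ t = γ₂ t) :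
    SolvesAt (fun t x y => H₁ t x y + H₂ t x y) γ t := by
  rcases lt_trichotomy t τ with h | rfl | h
  · exact h₁.congr ((eventually_le_nhds h).mono hγ₁) fun x y => by simp [hH₂ t x y h.le]
  · have e₁ := h₁.hasDerivAt_zero fun x y => hH₁ t x y le_rfl
    have e₂ := h₂.hasDerivAt_zero fun x y => hH₂ t x y le_rfl
    have := (e₁.hasDerivWithinAt.congr (s := Set.Iic t) hγ₁ (hγ₁ t le_rfl)).union
      (e₂.hasDerivWithinAt.congr (s := Set.Ici t) hγ₂ (hγ₂ t le_rfl))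
    rw [Set.Iic_union_Ici, hasDerivWithinAt_univ] at this
    unfold SolvesAt
    simp only [hH₁ t _ _ le_rfl, hH₂ t _ _ le_rfl, add_zero, deriv_const, neg_zero]
    exact this
  · exact h₂.congr ((eventually_ge_nhds h).mono hγ₂) fun x y => by simp [hH₁ t x y h.le]

end SolvesAt

/-- A smooth Hamiltonian `H`, of period `1` in `x` and vanishing for `t ∉ (0, 1)`, and its flow `φ`,
which is defined on the whole plane and preserves the strip `ℝ × [a,b]`. Vanishing outside the unit
time interval is what makes such motions composable and extendable with period `1` in time. -/
structure IsUnitTimeMotion (a b : ℝ) (H : ℝ → ℝ → ℝ → ℝ) (φ : ℝ → Equiv.Perm (ℝ × ℝ)) :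
    Prop where
  smooth : ContDiff ℝ ∞ fun q : ℝ × ℝ × ℝ => H q.1 q.2.1 q.2.2
  periodic_x : ∀ t x y, H t (x + 1) y = H t x y
  zero_of_nonpos : ∀ t x y, t ≤ 0 → H t x y = 0
  zero_of_one_le : ∀ t x y, 1 ≤ t → H t x y = 0
  flow_of_nonpos : ∀ t ≤ 0, φ t = 1
  flow_of_one_le : ∀ t, 1 ≤ t → φ t = φ 1
  mem_iff : ∀ t q, (φ t q).2 ∈ Set.Icc a b ↔ q.2 ∈ Set.Icc a b
  solves : ∀ q t, SolvesAt H (fun s => φ s q) t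

namespace IsUnitTimeMotion

variable {a b : ℝ} {H H₁ H₂ : ℝ → ℝ → ℝ → ℝ} {φ φ₁ φ₂ : ℝ → Equiv.Perm (ℝ × ℝ)}

theorem rest (a b : ℝ) : IsUnitTimeMotion a b (fun _ _ _ => 0) fun _ => 1 where
  smooth := contDiff_const
  periodic_x _ _ _ := rfl
  zero_of_nonpos _ _ _ _ := rfl
  zero_of_one_le _ _ _ _ := rfl
  flow_of_nonpos _ _ := rfl
  flow_of_one_le _ _ := rfl
  mem_iff _ _ := Iff.rfl
  solves q t := by
    unfold SolvesAt
    simp only [deriv_const, neg_zero]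
    exact hasDerivAt_const t q

/-- One motion in the time interval `[0, 1/2]` and then another one in `[1/2, 1]`. -/
theorem trans (h₁ : IsUnitTimeMotion a b H₁ φ₁) (h₂ : IsUnitTimeMotion a b H₂ φ₂) :
    IsUnitTimeMotion a b
      (fun t x y => 2 * H₁ (2 * t + 0) x y + 2 * H₂ (2 * t + -1) x y)
      (fun t => φ₂ (2 * t + -1) * φ₁ (2 * t + 0)) where
  smooth := by
    have hH₁ := h₁.smooth.comp (f := fun q : ℝ × ℝ × ℝ => (2 * q.1 + 0, q.2)) (by fun_prop)
    have hH₂ := h₂.smooth.comp (f := fun q : ℝ × ℝ × ℝ => (2 * q.1 + -1, q.2)) (by fun_prop)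
    exact (contDiff_const.mul hH₁).add (contDiff_const.mul hH₂)
  periodic_x t x y := by rw [h₁.periodic_x, h₂.periodic_x]
  zero_of_nonpos t x y ht := by
    rw [h₁.zero_of_nonpos _ _ _ (by linarith), h₂.zero_of_nonpos _ _ _ (by linarith)]; simp
  zero_of_one_le t x y ht := by
    rw [h₁.zero_of_one_le _ _ _ (by linarith), h₂.zero_of_one_le _ _ _ (by linarith)]; simp
  flow_of_nonpos t ht := by
    rw [h₁.flow_of_nonpos _ (by linarith), h₂.flow_of_nonpos _ (by linarith), one_mul]
  flow_of_one_le t ht := by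
    rw [h₁.flow_of_one_le _ (by linarith), h₂.flow_of_one_le _ (by linarith),
      h₁.flow_of_one_le (2 * 1 + 0) (by norm_num), h₂.flow_of_one_le (2 * 1 + -1) (by norm_num)]
  mem_iff t q := by rw [Equiv.Perm.mul_apply, h₂.mem_iff, h₁.mem_iff]
  solves q t := by
    refine SolvesAt.glue (τ := 1 / 2) (h₁.solves q _).comp_affine
      (h₂.solves (φ₁ 1 q) _).comp_affine ?_ ?_ ?_ ?_
    · intro t x y ht
      simp only [h₁.zero_of_one_le (2 * t + 0) x y (by linarith), mul_zero]
    · intro t x y ht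
      simp only [h₂.zero_of_nonpos (2 * t + -1) x y (by linarith), mul_zero]
    · intro t ht
      simp only [h₂.flow_of_nonpos (2 * t + -1) (by linarith), one_mul]
    · intro t ht
      simp only [h₁.flow_of_one_le (2 * t + 0) (by linarith), Equiv.Perm.mul_apply]

theorem isSmoothHamiltonian (h : IsUnitTimeMotion a b H φ) :
    IsSmoothHamiltonian a b fun t => H (Int.fract t) where
  smooth := (ContDiff.comp_fract_fst h.smooth (fun t z => h.zero_of_nonpos t z.1 z.2)
    (fun t z => h.zero_of_one_le t z.1 z.2)).contDiffOn
  periodic_t t x y _ := by rw [Int.fract_add_one]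
  periodic_x t x y _ := h.periodic_x _ x y

/-- The motion, repeated with period `1` in time: after `⌊t⌋` full periods it continues with the
flow at the fractional part of `t`. -/
theorem solvesAt_fract (h : IsUnitTimeMotion a b H φ) (q : ℝ × ℝ) (t : ℝ) :
    SolvesAt (fun t => H (Int.fract t))
      (fun t => φ (Int.fract t) ((φ 1 ^ ⌊t⌋) q)) t := by
  set k := ⌊t⌋ with hk
  -- near `t` the curve runs through the periods `[k - 1, k]` and `[k, k + 1]` only
  have key : SolvesAt (fun t x y => 1 * H (1 * t + (1 - k)) x y + 1 * H (1 * t + (-k)) x y)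
      (fun t => φ (1 * t + (-k)) (φ (1 * t + (1 - k)) ((φ 1 ^ (k - 1)) q))) t := by
    refine SolvesAt.glue (τ := k) (h.solves ((φ 1 ^ (k - 1)) q) _).comp_affine
      (h.solves (φ 1 ((φ 1 ^ (k - 1)) q)) _).comp_affine ?_ ?_ ?_ ?_
    · intro t x y ht
      simp only [h.zero_of_one_le (1 * t + (1 - k)) x y (by linarith), mul_zero]
    · intro t x y ht
      simp only [h.zero_of_nonpos (1 * t + (-k)) x y (by linarith), mul_zero]
    · intro t ht
      simp only [h.flow_of_nonpos (1 * t + (-k)) (by linarith), Equiv.Perm.one_apply]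
    · intro t ht
      simp only [h.flow_of_one_le (1 * t + (1 - k)) (by linarith)]
  have hnear := eventually_mem_floor_Ioo t
  rw [← hk] at hnear
  refine key.congr (hnear.mono fun s hs => ?_) fun x y => ?_
  · rcases le_or_gt (k : ℝ) s with hks | hks
    · have hfl : ⌊s⌋ = k := Int.floor_eq_iff.2 ⟨hks, hs.2⟩
      have hpow : (φ 1 ^ k) q = φ 1 ((φ 1 ^ (k - 1)) q) := by
        rw [← Equiv.Perm.mul_apply, ← zpow_one_add, add_sub_cancel]
      simp only [Int.fract, hfl, h.flow_of_one_le (1 * s + (1 - k)) (by linarith), hpow]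
      ring_nf
    · have hfl : ⌊s⌋ = k - 1 := Int.floor_eq_iff.2 ⟨by push_cast; linarith [hs.1], by
        push_cast; linarith⟩
      simp only [Int.fract, hfl, h.flow_of_nonpos (1 * s + (-k)) (by linarith),
        Equiv.Perm.one_apply]
      push_cast
      ring_nf
  · have hs := hnear.self_of_nhds
    rw [apply_fract_eq_add (f := fun t => H t x y) (fun t => h.zero_of_nonpos t x y)
      (fun t => h.zero_of_one_le t x y) hs.1 hs.2]
    ring_nf

theorem periodicFlow_mem (h : IsUnitTimeMotion a b H φ) (t : ℝ) {q : ℝ × ℝ}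
    (hq : q.2 ∈ Set.Icc a b) : (φ (Int.fract t) ((φ 1 ^ ⌊t⌋) q)).2 ∈ Set.Icc a b := by
  rw [h.mem_iff]
  have hpow : ∀ n : ℕ, ∀ q : ℝ × ℝ,
      ((φ 1 ^ n) q).2 ∈ Set.Icc a b ↔ q.2 ∈ Set.Icc a b := by
    intro n
    induction n with
    | zero => intro q; simp
    | succ n ih => intro q; rw [pow_succ, Equiv.Perm.mul_apply, ih, h.mem_iff]
  obtain ⟨n, hn | hn⟩ := Int.eq_nat_or_neg ⌊t⌋
  · rw [hn, zpow_natCast, hpow]; exact hq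
  · rw [hn, zpow_neg, zpow_natCast, ← hpow n, Equiv.Perm.inv_def, Equiv.apply_symm_apply]; exact hq

theorem isHamiltonianFlow (hab : a < b) (h : IsUnitTimeMotion a b H φ) :
    IsHamiltonianFlow a b (fun t => H (Int.fract t))
      (fun t q => φ (Int.fract t) ((φ 1 ^ ⌊t⌋) q)) where
  init q _ := by simp [h.flow_of_nonpos 0 le_rfl]
  mem t _ hq := h.periodicFlow_mem t hq
  deriv_x t q hq := by
    have hs := h.solvesAt_fract q t
    unfold SolvesAt at hs
    rw [DifferentiableAt.derivWithin ?_ (uniqueDiffOn_Icc hab _ (h.periodicFlow_mem t hq))]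
    · exact hs.fst
    · exact (h.smooth.differentiable (by simp)).differentiableAt.comp _
        (f := fun y => (Int.fract t, (φ (Int.fract t) ((φ 1 ^ ⌊t⌋) q)).1, y)) (by fun_prop)
  deriv_y t q _ := (h.solvesAt_fract q t).snd

end IsUnitTimeMotion

/-! ### Half twists as Hamiltonian motions -/

/-- A smooth function of `r` that equals `r` near `r = e` and vanishes for `r ≥ 3e`. With `r` the
squared distance to a centre, its Hamiltonian flow rotates rigidly near the circle `r = e` and is at
rest outside the disc `r < 3e`. -/
noncomputable def twistProfile (e r : ℝ) : ℝ := r * Real.smoothTransition (3 - r / e)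

theorem contDiff_twistProfile (e : ℝ) : ContDiff ℝ ∞ (twistProfile e) := by
  unfold twistProfile
  exact contDiff_id.mul (Real.smoothTransition.contDiff.comp (by fun_prop))

theorem hasDerivAt_twistProfile (e r : ℝ) :
    HasDerivAt (twistProfile e) (deriv (twistProfile e) r) r :=
  ((contDiff_twistProfile e).differentiable (by simp)).differentiableAt.hasDerivAt

theorem twistProfile_eq_zero {e r : ℝ} (he : 0 < e) (hr : 3 * e ≤ r) : twistProfile e r = 0 := by
  have : 3 ≤ r / e := (le_div_iff₀ he).2 hr
  rw [twistProfile, Real.smoothTransition.zero_of_nonpos (by linarith), mul_zero]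

theorem deriv_twistProfile_eq_zero {e r : ℝ} (he : 0 < e) (hr : 3 * e ≤ r) :
    deriv (twistProfile e) r = 0 :=
  (hasDerivAt_twistProfile e r).eq_zero_of_eqOn_Ici (c := 0) fun _ hs =>
    twistProfile_eq_zero he (hr.trans hs)

theorem deriv_twistProfile_self {e : ℝ} (he : 0 < e) : deriv (twistProfile e) e = 1 := by
  have : twistProfile e =ᶠ[nhds e] id := by
    filter_upwards [Iio_mem_nhds (show e < 2 * e by linarith)] with r hr
    have : r / e ≤ 2 := (div_le_iff₀ he).2 (le_of_lt hr)
    rw [twistProfile, Real.smoothTransition.one_of_one_le (by linarith), mul_one, id]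
  rw [this.deriv_eq, deriv_id]

/-- The representative in `[-1/2, 1/2)` of `x` modulo `1`. -/
noncomputable def centeredFract (x : ℝ) : ℝ := Int.fract (x + 1 / 2) - 1 / 2

theorem centeredFract_add_int_of_mem {u : ℝ} (h1 : -(1 / 2) ≤ u) (h2 : u < 1 / 2) (k : ℤ) :
    centeredFract (u + k) = u := by
  have : Int.fract (u + k + 1 / 2) = u + 1 / 2 := by
    rw [Int.fract_eq_iff]; exact ⟨by linarith, by linarith, k, by ring⟩
  rw [centeredFract, this]; ring

theorem centeredFract_of_mem {u : ℝ} (h1 : -(1 / 2) ≤ u) (h2 : u < 1 / 2) :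
    centeredFract u = u := by
  simpa using centeredFract_add_int_of_mem h1 h2 0

theorem eq_centeredFract_add (x : ℝ) : x = centeredFract x + ⌊x + 1 / 2⌋ := by
  rw [centeredFract, Int.fract]; ring

/-- The squared distance from the point `q` to the nearest of the centres `(m + k, c)`, `k ∈ ℤ`,
that is, to `(m, c)` in the annulus. -/
noncomputable def sqDist (m c : ℝ) (q : ℝ × ℝ) : ℝ := centeredFract (q.1 - m) ^ 2 + (q.2 - c) ^ 2

/-- The rotation of the plane about the nearest of the centres `(m + k, c)`, `k ∈ ℤ`, clockwise by
`τ` times the derivative of `twistProfile e` at the squared distance to that centre. -/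
noncomputable def twistMap (m c e τ : ℝ) (q : ℝ × ℝ) : ℝ × ℝ :=
  let α := deriv (twistProfile e) (sqDist m c q) * τ
  (m + ⌊q.1 - m + 1 / 2⌋ +
      (centeredFract (q.1 - m) * Real.cos α + (q.2 - c) * Real.sin α),
    c + (-(centeredFract (q.1 - m)) * Real.sin α + (q.2 - c) * Real.cos α))

section

variable {m c e : ℝ}

theorem twistMap_of_le (he : 0 < e) (τ : ℝ) {q : ℝ × ℝ} (hq : 3 * e ≤ sqDist m c q) :
    twistMap m c e τ q = q := by
  have := eq_centeredFract_add (q.1 - m)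
  ext <;> simp [twistMap, deriv_twistProfile_eq_zero he hq]
  simp at this
  linarith

theorem twistMap_zero (q : ℝ × ℝ) : twistMap m c e 0 q = q := by
  have := eq_centeredFract_add (q.1 - m)
  ext <;> simp [twistMap]
  simp at this
  linarith

/-- As the rotated discs have radius at most `1/2`, a point stays near the same centre. -/
theorem centeredFract_twistMap (he : 0 < e) (he' : 3 * e ≤ 1 / 4) (τ : ℝ) (q : ℝ × ℝ) :
    centeredFract ((twistMap m c e τ q).1 - m) =
      (twistMap m c e τ q).1 - m - ⌊q.1 - m + 1 / 2⌋ := by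
  rcases le_or_gt (3 * e) (sqDist m c q) with h | h
  · rw [twistMap_of_le he τ h]
    linarith [eq_centeredFract_add (q.1 - m)]
  · set α := deriv (twistProfile e) (sqDist m c q) * τ with hα
    set u := centeredFract (q.1 - m) with hu
    have hr : u ^ 2 + (q.2 - c) ^ 2 < 1 / 4 := lt_of_lt_of_le h he'
    have hle : (u * Real.cos α + (q.2 - c) * Real.sin α) ^ 2 < (1 / 2) ^ 2 := by
      nlinarith [Real.sin_sq_add_cos_sq α, sq_nonneg (-u * Real.sin α + (q.2 - c) * Real.cos α)]
    have habs := abs_lt_of_sq_lt_sq hle (by norm_num)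
    have h1 : (twistMap m c e τ q).1 - m =
        u * Real.cos α + (q.2 - c) * Real.sin α + (⌊q.1 - m + 1 / 2⌋ : ℤ) := by
      simp only [twistMap, ← hα, ← hu]; ring
    rw [h1, centeredFract_add_int_of_mem (abs_lt.1 habs).1.le (abs_lt.1 habs).2]
    ring

theorem sqDist_twistMap (he : 0 < e) (he' : 3 * e ≤ 1 / 4) (τ : ℝ) (q : ℝ × ℝ) :
    sqDist m c (twistMap m c e τ q) = sqDist m c q := by
  rw [sqDist, centeredFract_twistMap he he']
  simp only [twistMap]
  set α := deriv (twistProfile e) (sqDist m c q) * τ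
  rw [sqDist]
  have := Real.sin_sq_add_cos_sq α
  linear_combination (centeredFract (q.1 - m) ^ 2 + (q.2 - c) ^ 2) * this

theorem floor_twistMap (he : 0 < e) (he' : 3 * e ≤ 1 / 4) (τ : ℝ) (q : ℝ × ℝ) :
    ⌊(twistMap m c e τ q).1 - m + 1 / 2⌋ = ⌊q.1 - m + 1 / 2⌋ := by
  have h1 := centeredFract_twistMap (m := m) (c := c) he he' τ q
  have h2 := eq_centeredFract_add ((twistMap m c e τ q).1 - m)
  have : ((⌊(twistMap m c e τ q).1 - m + 1 / 2⌋ : ℤ) : ℝ) = ⌊q.1 - m + 1 / 2⌋ := by linarith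
  exact_mod_cast this

theorem twistMap_twistMap (he : 0 < e) (he' : 3 * e ≤ 1 / 4) (τ : ℝ) (q : ℝ × ℝ) :
    twistMap m c e (-τ) (twistMap m c e τ q) = q := by
  have hq := eq_centeredFract_add (q.1 - m)
  have hC := centeredFract_twistMap (m := m) (c := c) he he' τ q
  have hF := floor_twistMap (m := m) (c := c) he he' τ q
  have hS := sqDist_twistMap (m := m) (c := c) he he' τ q
  set p := twistMap m c e τ q with hp
  have hsc := Real.sin_sq_add_cos_sq (deriv (twistProfile e) (sqDist m c q) * τ)
  unfold twistMap
  simp only [hF, hS, hC, mul_neg, Real.cos_neg, Real.sin_neg]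
  simp only [hp, twistMap]
  set α := deriv (twistProfile e) (sqDist m c q) * τ
  ext
  · simp only
    linear_combination centeredFract (q.1 - m) * hsc - hq
  · simp only
    linear_combination (q.2 - c) * hsc

/-- `twistMap` as a bijection of the plane. -/
noncomputable def twistPerm (m c : ℝ) (he : 0 < e) (he' : 3 * e ≤ 1 / 4) (τ : ℝ) :
    Equiv.Perm (ℝ × ℝ) where
  toFun := twistMap m c e τ
  invFun := twistMap m c e (-τ)
  left_inv := twistMap_twistMap he he' τ
  right_inv q := by simpa using twistMap_twistMap (m := m) (c := c) he he' (-τ) q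

theorem twistMap_mem_Icc {a b : ℝ} (he : 0 < e) (ha : 3 * e ≤ (c - a) ^ 2)
    (hb : 3 * e ≤ (b - c) ^ 2) (hc : c ∈ Set.Icc a b) (he' : 3 * e ≤ 1 / 4) (τ : ℝ) {q : ℝ × ℝ}
    (hq : q.2 ∈ Set.Icc a b) : (twistMap m c e τ q).2 ∈ Set.Icc a b := by
  rcases le_or_gt (3 * e) (sqDist m c q) with h | h
  · rwa [twistMap_of_le he τ h]
  · rw [← sqDist_twistMap he he' τ q, sqDist] at h
    have h1 := sq_nonneg (centeredFract ((twistMap m c e τ q).1 - m))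
    constructor
    · nlinarith [hc.1]
    · nlinarith [hc.2]

end

/-- The Hamiltonian that generates `twistMap` about the centres `(m + k, c)`, `k ∈ ℤ`, through the
total angle `s π`, spread over the time interval `[0, 1]`. -/
noncomputable def twistHamiltonian (m c e s t x y : ℝ) : ℝ :=
  s * Real.pi / 2 * deriv Real.smoothTransition t * twistProfile e (sqDist m c (x, y))

theorem hasDerivAt_smoothTransition (t : ℝ) :
    HasDerivAt Real.smoothTransition (deriv Real.smoothTransition t) t :=
  ((Real.smoothTransition.contDiff (n := 1)).differentiable (by simp)).differentiableAt.hasDerivAt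

theorem twistProfile_outer {e t y : ℝ} (he : 0 < e) (he' : 3 * e ≤ 1 / 4) (ht : t ≤ 0 ∨ 1 ≤ t) :
    twistProfile e ((t - 1 / 2) ^ 2 + y ^ 2) = 0 := by
  refine twistProfile_eq_zero he ?_
  rcases ht with h | h <;> nlinarith [sq_nonneg y]

theorem contDiff_twistProfile_sqDist {m c e : ℝ} (he : 0 < e) (he' : 3 * e ≤ 1 / 4) :
    ContDiff ℝ ∞ fun q : ℝ × ℝ => twistProfile e (sqDist m c q) := by
  have h := ContDiff.comp_fract_fst
    (f := fun p : ℝ × ℝ => twistProfile e ((p.1 - 1 / 2) ^ 2 + (p.2 - c) ^ 2))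
    ((contDiff_twistProfile e).comp (by fun_prop))
    (fun t z ht => twistProfile_outer he he' (.inl ht))
    (fun t z ht => twistProfile_outer he he' (.inr ht))
  exact h.comp (f := fun q : ℝ × ℝ => (q.1 - m + 1 / 2, q.2)) (by fun_prop)

theorem hasDerivAt_twistProfile_sqDist_fst {m c e : ℝ} (he : 0 < e) (he' : 3 * e ≤ 1 / 4)
    (x y : ℝ) : HasDerivAt (fun x => twistProfile e (sqDist m c (x, y)))
      (deriv (twistProfile e) (sqDist m c (x, y)) * (2 * centeredFract (x - m))) x := by
  have h := hasDerivAt_comp_fract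
    (f := fun t => twistProfile e ((t - 1 / 2) ^ 2 + (y - c) ^ 2))
    (f' := fun t => deriv (twistProfile e) ((t - 1 / 2) ^ 2 + (y - c) ^ 2) * (2 * (t - 1 / 2)))
    (fun t => by
      have h1 := ((((hasDerivAt_id t).sub_const (1 / 2)).pow 2).add_const ((y - c) ^ 2))
      simpa [Function.comp_def] using (hasDerivAt_twistProfile e _).comp t h1)
    (fun t ht => twistProfile_outer he he' (.inl ht))
    (fun t ht => twistProfile_outer he he' (.inr ht)) (x - m + 1 / 2)
  have h2 := h.comp x (((hasDerivAt_id x).sub_const m).add_const (1 / 2))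
  simpa [Function.comp_def, sqDist, centeredFract] using h2

theorem hasDerivAt_twistProfile_sqDist_snd (m c e x y : ℝ) :
    HasDerivAt (fun y => twistProfile e (sqDist m c (x, y)))
      (deriv (twistProfile e) (sqDist m c (x, y)) * (2 * (y - c))) y := by
  have h1 := (((hasDerivAt_id y).sub_const c).pow 2).const_add (centeredFract (x - m) ^ 2)
  simpa [Function.comp_def, sqDist] using (hasDerivAt_twistProfile e _).comp y h1

theorem isUnitTimeMotion_twist {a b m c e : ℝ} (s : ℝ) (he : 0 < e) (he' : 3 * e ≤ 1 / 4)
    (ha : 3 * e ≤ (c - a) ^ 2) (hb : 3 * e ≤ (b - c) ^ 2) (hc : c ∈ Set.Icc a b) :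
    IsUnitTimeMotion a b (twistHamiltonian m c e s)
      (fun t => twistPerm m c he he' (s * Real.pi * Real.smoothTransition t)) where
  smooth := by
    have h1 : ContDiff ℝ ∞ (deriv Real.smoothTransition) :=
      (contDiff_infty_iff_deriv.1 Real.smoothTransition.contDiff).2
    exact (contDiff_const.mul (h1.comp contDiff_fst)).mul
      ((contDiff_twistProfile_sqDist he he').comp contDiff_snd)
  periodic_x t x y := by
    have : x + 1 - m + 1 / 2 = x - m + 1 / 2 + 1 := by ring
    simp only [twistHamiltonian, sqDist, centeredFract, this, Int.fract_add_one]
  zero_of_nonpos t x y ht := by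
    have := (hasDerivAt_smoothTransition t).eq_zero_of_eqOn_Iic (c := 0) fun s hs =>
      Real.smoothTransition.zero_of_nonpos (hs.trans ht)
    simp [twistHamiltonian, this]
  zero_of_one_le t x y ht := by
    have := (hasDerivAt_smoothTransition t).eq_zero_of_eqOn_Ici (c := 1) fun s hs =>
      Real.smoothTransition.one_of_one_le (ht.trans hs)
    simp [twistHamiltonian, this]
  flow_of_nonpos t ht := by
    ext1 q
    simpa [Real.smoothTransition.zero_of_nonpos ht, twistPerm] using twistMap_zero q
  flow_of_one_le t ht := by
    rw [Real.smoothTransition.one_of_one_le ht, Real.smoothTransition.one]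
  mem_iff t q := by
    refine ⟨fun h => ?_, fun h => twistMap_mem_Icc he ha hb hc he' _ h⟩
    rw [← twistMap_twistMap (m := m) (c := c) he he'
      (s * Real.pi * Real.smoothTransition t) q]
    exact twistMap_mem_Icc he ha hb hc he' _ h
  solves q t := by
    set τ := s * Real.pi * Real.smoothTransition t with hτ
    have hC := centeredFract_twistMap (m := m) (c := c) he he' τ q
    have hS := sqDist_twistMap (m := m) (c := c) he he' τ q
    have hx := (hasDerivAt_twistProfile_sqDist_fst (m := m) (c := c) he he'
      (twistMap m c e τ q).1 (twistMap m c e τ q).2).const_mul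
        (s * Real.pi / 2 * deriv Real.smoothTransition t)
    have hy := (hasDerivAt_twistProfile_sqDist_snd m c e
      (twistMap m c e τ q).1 (twistMap m c e τ q).2).const_mul
        (s * Real.pi / 2 * deriv Real.smoothTransition t)
    have hα := (((hasDerivAt_smoothTransition t).const_mul (s * Real.pi)).const_mul
      (deriv (twistProfile e) (sqDist m c q)))
    have e1 := (((hα.cos).const_mul (centeredFract (q.1 - m))).add
      ((hα.sin).const_mul (q.2 - c))).const_add (m + ⌊q.1 - m + 1 / 2⌋)
    have e2 := (((hα.sin).const_mul (-centeredFract (q.1 - m))).add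
      ((hα.cos).const_mul (q.2 - c))).const_add c
    unfold SolvesAt
    refine (e1.prodMk e2).congr_deriv ?_
    change _ = (deriv (fun y => twistHamiltonian m c e s t (twistMap m c e τ q).1 y)
      (twistMap m c e τ q).2, -deriv (fun x => twistHamiltonian m c e s t x
      (twistMap m c e τ q).2) (twistMap m c e τ q).1)
    unfold twistHamiltonian
    rw [hx.deriv, hy.deriv, Prod.mk.eta, hS, hC]
    simp only [twistMap, ← hτ]
    ext
    · simp only; ring
    · simp only; ring

/-! ### Reparametrised words of half twists -/

namespace GeometricBraid

variable {n : ℕ} {p : Fin n → ℝ × ℝ}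

/-- The geometric braid `β` run through at the speed given by the path `θ` from `0` to `1`. -/
def reparam (β : GeometricBraid p) (θ : Path (0 : I) 1) : GeometricBraid p where
  perm := β.perm
  strand i := (β.strand i).reparam θ θ.continuous θ.source θ.target
  disjoint t := β.disjoint (θ t)

end GeometricBraid

/-- The product of the elementary braids of the letters of a word, each of them run through at the
speed given by `θ`. -/
noncomputable def wordBraidReparam {n : ℕ} {x : Fin n → ℝ} (hx : StrictMono x) (c : ℝ)
    (θ : Path (0 : I) 1) : List (Fin (n - 1) × Bool) → GeometricBraid (linePoints x c)
  | [] => GeometricBraid.trivial (linePoints_injective hx c)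
  | l :: w => ((halfTwist hx c l.1 l.2).reparam θ).comp (wordBraidReparam hx c θ w)

section

variable {n : ℕ} {x : Fin n → ℝ} (hx : StrictMono x) (c : ℝ)

theorem continuous_wordBraidReparam {θ : I → Path (0 : I) 1}
    (hθ : Continuous fun q : I × I => θ q.1 q.2) (w : List (Fin (n - 1) × Bool)) (i : Fin n) :
    Continuous fun q : I × I => (wordBraidReparam hx c (θ q.1) w).strand i q.2 := by
  induction w generalizing i with
  | nil => exact continuous_const
  | cons l w ih =>
    exact Path.trans_continuous_family
      (fun s => ((halfTwist hx c l.1 l.2).reparam (θ s)).strand i)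
      (((halfTwist hx c l.1 l.2).strand i).continuous.comp hθ)
      (fun s => (wordBraidReparam hx c (θ s) w).strand
        (Equiv.swap (leftStrand l.1) (rightStrand l.1) i)) (ih _)

theorem wordBraidReparam_id {θ : Path (0 : I) 1} (hθ : ∀ t, θ t = t)
    (w : List (Fin (n - 1) × Bool)) (i : Fin n) (t : I) :
    (wordBraidReparam hx c θ w).strand i t = (wordBraid hx c w).strand i t := by
  induction w generalizing i t with
  | nil => rfl
  | cons l w ih =>
    refine (Path.trans_apply _ _ t).trans (Eq.trans ?_ (Path.trans_apply _ _ t).symm)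
    split_ifs with h
    · exact congrArg ((halfTwist hx c l.1 l.2).strand i) (hθ _)
    · exact ih _ _

/-- The straight-line homotopy from `θ` to the identity of `[0, 1]`. -/
def linearReparam (θ : Path (0 : I) 1) (s : I) : Path (0 : I) 1 where
  toFun t := ⟨(1 - s) * θ t + s * t, by
    have h1 := s.2; have h2 := (θ t).2; have h3 := t.2
    constructor
    · exact add_nonneg (mul_nonneg (by linarith [h1.2]) h2.1) (mul_nonneg h1.1 h3.1)
    · nlinarith [h1.1, h1.2, h2.2, h3.2]⟩
  continuous_toFun := by fun_prop
  source' := by ext; simp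
  target' := by ext; simp

theorem wordBraidReparam_isotopic (θ : Path (0 : I) 1) (w : List (Fin (n - 1) × Bool)) :
    (wordBraidReparam hx c θ w).Isotopic (wordBraid hx c w) := by
  refine ⟨fun s => wordBraidReparam hx c (linearReparam θ s) w, fun i => ?_, fun i t => ?_,
    fun i t => ?_⟩
  · refine continuous_wordBraidReparam hx c ?_ w i
    refine Continuous.subtype_mk ?_ _
    fun_prop
  · have : linearReparam θ 0 = θ := by ext t; simp [linearReparam]
    change (wordBraidReparam hx c (linearReparam θ 0) w).strand i t = _
    rw [this]
  · exact wordBraidReparam_id hx c (fun t => by ext; simp [linearReparam]) w i t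

end

/-! ### Realising a word of half twists -/

theorem twistMap_of_sq_eq {m c e u τ : ℝ} (he : 0 < e) (he' : 3 * e ≤ 1 / 4) (hu : u ^ 2 = e) :
    twistMap m c e τ (m + u, c) = (m + u * Real.cos τ, c - u * Real.sin τ) := by
  have hlt : u ^ 2 < (1 / 2) ^ 2 := by rw [hu]; linarith
  have habs := abs_lt.1 (abs_lt_of_sq_lt_sq hlt (by norm_num))
  have hC : centeredFract (m + u - m) = u := by
    rw [add_sub_cancel_left, centeredFract_of_mem habs.1.le habs.2]
  have hfl : (⌊m + u - m + 1 / 2⌋ : ℝ) = 0 := by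
    linarith [eq_centeredFract_add (m + u - m)]
  have hS : sqDist m c (m + u, c) = e := by simp only [sqDist, hC, hu]; ring
  simp only [twistMap, hS, hC, hfl, deriv_twistProfile_self he]
  ext <;> simp
  ring

section

variable {n : ℕ} {δ : ℝ}

/-- A point of an equally spaced configuration of total width less than `1` that is neither `i` nor
`i + 1` stays away from all translates of the midpoint of these two. -/
theorem three_mul_le_centeredFract_sq (hδ : 0 < δ) (hn : δ * (n + 2) ≤ 1) (i : Fin (n - 1))
    {j : Fin n} (hl : j ≠ leftStrand i) (hr : j ≠ rightStrand i) :
    3 * (δ ^ 2 / 4) ≤ centeredFract (δ * j - δ * (i + 1 / 2)) ^ 2 := by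
  have hk := eq_centeredFract_add (δ * j - δ * (i + 1 / 2))
  set k := ⌊δ * j - δ * (i + 1 / 2) + 1 / 2⌋
  set u := centeredFract (δ * j - δ * (i + 1 / 2))
  have hjn : (j : ℝ) + 1 ≤ n := by exact_mod_cast j.2
  have hin : (i : ℝ) + 2 ≤ n := by
    have := i.2
    exact_mod_cast (show (i : ℕ) + 2 ≤ n by omega)
  have hj0 : (0 : ℝ) ≤ j := Nat.cast_nonneg _
  have hi0 : (0 : ℝ) ≤ i := Nat.cast_nonneg _
  have hu : δ ≤ |u| := by
    rw [le_abs']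
    rcases lt_trichotomy k 0 with h | h | h
    · have : (k : ℝ) ≤ -1 := by exact_mod_cast Int.le_sub_one_of_lt h
      right; nlinarith
    · rw [h, Int.cast_zero, add_zero] at hk
      simp only [ne_eq, Fin.ext_iff, leftStrand, rightStrand] at hl hr
      rcases lt_or_gt_of_ne hl with h' | h'
      · have : (j : ℝ) + 1 ≤ i := by exact_mod_cast h'
        left; nlinarith
      · have : (i : ℝ) + 2 ≤ j := by exact_mod_cast (show (i : ℕ) + 2 ≤ j by omega)
        right; nlinarith
    · have : (1 : ℝ) ≤ k := by exact_mod_cast h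
      left; nlinarith
  have := mul_self_le_mul_self hδ.le hu
  rw [abs_mul_abs_self] at this
  nlinarith

theorem twistMap_eq_halfTwistFun (c : ℝ) (hδ : 0 < δ) (hn : δ * (n + 2) ≤ 1)
    (he' : 3 * (δ ^ 2 / 4) ≤ 1 / 4) (i : Fin (n - 1)) {s : ℝ} (hs : s = 1 ∨ s = -1) (t : ℝ)
    (j : Fin n) :
    twistMap (δ * (i + 1 / 2)) c (δ ^ 2 / 4) (s * Real.pi * t)
      (linePoints (fun k : Fin n => δ * k) c j) =
        halfTwistFun (fun k : Fin n => δ * k) c i s j t := by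
  have he : 0 < δ ^ 2 / 4 := by positivity
  have hcos : Real.cos (s * Real.pi * t) = Real.cos (Real.pi * t) := by
    rcases hs with rfl | rfl <;> simp
  have hsin : Real.sin (s * Real.pi * t) = s * Real.sin (Real.pi * t) := by
    rcases hs with rfl | rfl <;> simp
  unfold halfTwistFun linePoints
  split_ifs with h1 h2
  · subst h1
    have := twistMap_of_sq_eq (m := δ * (i + 1 / 2)) (c := c) (u := -(δ / 2))
      (τ := s * Real.pi * t) he he' (by ring)
    simp only [leftStrand, rightStrand]
    rw [show δ * (i : ℕ) = δ * (i + 1 / 2) + -(δ / 2) by ring, this, hcos, hsin]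
    ext <;> push_cast <;> ring
  · subst h2
    have := twistMap_of_sq_eq (m := δ * (i + 1 / 2)) (c := c) (u := δ / 2)
      (τ := s * Real.pi * t) he he' (by ring)
    simp only [leftStrand, rightStrand]
    rw [show δ * ((i + 1 : ℕ) : ℝ) = δ * (i + 1 / 2) + δ / 2 by push_cast; ring, this, hcos, hsin]
    ext <;> push_cast <;> ring
  · refine twistMap_of_le he _ ?_
    have := three_mul_le_centeredFract_sq hδ hn i h1 h2
    simp only [sqDist]
    nlinarith

/-- The function `Real.smoothTransition` as a path from `0` to `1`. -/
noncomputable def smoothTransitionPath : Path (0 : I) 1 where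
  toFun t := ⟨Real.smoothTransition t, Real.smoothTransition.nonneg _,
    Real.smoothTransition.le_one _⟩
  continuous_toFun := by
    have := Real.smoothTransition.continuous
    fun_prop
  source' := by ext; simp
  target' := by ext; simp

/-- Each letter of `w` is a twist about the midpoint of two neighbouring points, and the motions for
the letters follow one another in the same way as the elementary braids in the word braid. -/
theorem exists_motion_wordBraid {a b c : ℝ} (hc : c ∈ Set.Icc a b) (hδ : 0 < δ)
    (hn : δ * (n + 2) ≤ 1) (he' : 3 * (δ ^ 2 / 4) ≤ 1 / 4) (ha : 3 * (δ ^ 2 / 4) ≤ (c - a) ^ 2)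
    (hb : 3 * (δ ^ 2 / 4) ≤ (b - c) ^ 2) (hx : StrictMono fun k : Fin n => δ * k)
    (w : List (Fin (n - 1) × Bool)) :
    ∃ H φ, IsUnitTimeMotion a b H φ ∧ ∀ i, ∀ t : I,
      (wordBraidReparam hx c smoothTransitionPath w).strand i t =
        φ t (linePoints (fun k : Fin n => δ * k) c i) := by
  have he : 0 < δ ^ 2 / 4 := by positivity
  induction w with
  | nil => exact ⟨_, _, .rest a b, fun _ _ => rfl⟩
  | cons l w ih =>
    obtain ⟨H, φ, hH, hφ⟩ := ih
    set s : ℝ := if l.2 then 1 else -1 with hs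
    have hs' : s = 1 ∨ s = -1 := by rw [hs]; split_ifs <;> simp
    have h₁ := isUnitTimeMotion_twist (m := δ * (l.1 + 1 / 2)) s he he' ha hb hc
    have key : ∀ (j : Fin n) (t : ℝ), twistPerm (δ * (l.1 + 1 / 2)) c he he'
        (s * Real.pi * Real.smoothTransition t) (linePoints (fun k : Fin n => δ * k) c j) =
        halfTwistFun (fun k : Fin n => δ * k) c l.1 s j (Real.smoothTransition t) :=
      fun j t => twistMap_eq_halfTwistFun c hδ hn he' l.1 hs' _ j
    refine ⟨_, _, h₁.trans hH, fun i t => ?_⟩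
    refine (Path.trans_apply _ _ t).trans ?_
    rw [Equiv.Perm.mul_apply]
    split_ifs with h
    · rw [hH.flow_of_nonpos _ (by linarith), key, add_zero]
      rfl
    · rw [h₁.flow_of_one_le _ (by linarith), key, Real.smoothTransition.one, halfTwistFun_one,
        ← sub_eq_add_neg]
      exact hφ _ _

end

theorem theorem1p2 (n : ℕ) (a b : ℝ) (hab : a < b) (g : BraidGroup n) :
    ∃ (H : ℝ → ℝ → ℝ → ℝ) (φ : ℝ → ℝ × ℝ → ℝ × ℝ),
      IsSmoothHamiltonian a b H ∧ IsHamiltonianFlow a b H φ ∧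
      ∃ (x : Fin n → ℝ) (hx : StrictMono x) (c : ℝ),
        c ∈ Set.Icc a b ∧ (∀ i j, x i < x j + 1) ∧
        ∃ β : GeometricBraid (linePoints x c),
          (∀ i, ∀ t : unitInterval, β.strand i t = φ t (linePoints x c i)) ∧
          β.Represents hx g := by
  obtain ⟨v, rfl⟩ := PresentedGroup.mk_surjective _ g
  obtain ⟨w, rfl⟩ := Quot.exists_rep v
  -- the points lie in a segment of length less than `1`, and any disc of radius `δ` about a point
  -- of that segment lies in the strip
  obtain ⟨δ, hδ, hn, hδab⟩ : ∃ δ : ℝ, 0 < δ ∧ δ * (n + 2) ≤ 1 ∧ δ ≤ (b - a) / 2 := by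
    refine ⟨min (1 / (n + 2)) ((b - a) / 2), lt_min (by positivity) (by linarith), ?_,
      min_le_right _ _⟩
    rw [← le_div_iff₀ (by positivity)]
    exact min_le_left _ _
  have hn0 : (0 : ℝ) ≤ n := Nat.cast_nonneg n
  have hδ2 : δ ≤ 1 / 2 := by nlinarith
  have hsq : 3 * (δ ^ 2 / 4) ≤ ((b - a) / 2) ^ 2 := by nlinarith
  have hx : StrictMono fun k : Fin n => δ * k := fun i j hij =>
    mul_lt_mul_of_pos_left (Nat.cast_lt.2 hij) hδ
  have hc : (a + b) / 2 ∈ Set.Icc a b := ⟨by linarith, by linarith⟩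
  obtain ⟨H, φ, hH, hφ⟩ := exists_motion_wordBraid hc hδ hn (by nlinarith)
    (hsq.trans_eq (by ring)) (hsq.trans_eq (by ring)) hx w
  refine ⟨_, _, hH.isSmoothHamiltonian, hH.isHamiltonianFlow hab, fun k => δ * k, hx,
    (a + b) / 2, hc, fun i j => ?_, wordBraidReparam hx _ smoothTransitionPath w, fun i t => ?_,
    w, rfl, wordBraidReparam_isotopic hx _ _ w⟩
  · have hi : (i : ℝ) ≤ n := by exact_mod_cast i.2.le
    have hj : (0 : ℝ) ≤ j := Nat.cast_nonneg _
    simp only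
    nlinarith
  · rw [hφ]
    rcases eq_or_lt_of_le t.2.2 with ht | ht
    · simp [ht, hH.flow_of_nonpos 0 le_rfl]
    · have hfr : Int.fract (t : ℝ) = t := Int.fract_eq_self.2 ⟨t.2.1, ht⟩
      have hfl : ⌊(t : ℝ)⌋ = 0 := Int.floor_eq_zero_iff.2 ⟨t.2.1, ht⟩
      simp [hfr, hfl]
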